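/- Let $H$ be a real Hilbert space, $T>0$ and $\rho\in(0,+\infty]$, with the convention $\frac1{2\rho}=0$ if $\rho=+\infty$. For $S\subset H$ and $x\in S$, the proximal normal cone $N^P(S;x)$ is the set of $\zeta\in H$ for which there are $\sigma\ge 0$ and $\eta>0$ with $\langle\zeta,y-x\rangle\le\sigma\|y-x\|^2$ for all $y\in S$ with $\|y-x\|<\eta$ (that is, the proximal subdifferential at $x$ of the indicator function of $S$). A nonempty closed set $S$ is $\rho$-uniformly prox-regular if $\langle\zeta,x'-x\rangle\le\frac{\|\zeta\|}{2\rho}\|x'-x\|^2$ for all $x,x'\in S$ and $\zeta\in N^P(S;x)$. Let $C$ be a set-valued map from $[0,T]$ to subsets of $H$ such that: (H1) for every $t\in[0,T]$, $C(t)$ is nonempty, closed, connected and $\rho$-uniformly prox-regular; (H2) $C$ is lower semicontinuous on $[0,T]$: for every $\bar t\in[0,T]$ and every open $U\subset H$ with $C(\bar t)\cap U\ne\emptyset$, the set $\{t\in[0,T]: C(t)\cap U\neq\emptyset\}$ is a neighbourhood of $\bar t$ in $[0,T]$; (H3) for every bounded $x\colon[0,T]\to H$ with $x(t)\in C(t)$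 for all $t$ and every $\eta>0$ there is $R_{x,\eta}>0$ such that, for every compact $K\subset[0,T]$ and every continuous $y\colon K\to H$ with $y(t)\in C(t)$ and $\|y(t)-x(t)\|\le\eta$ for all $t\in K$, there is a continuous $\bar y\colon[0,T]\to H$ with $\bar y(t)\in C(t)$ and $\|\bar y(t)\|\le R_{x,\eta}$ for all $t\in[0,T]$, and $\bar y=y$ on $K$. Fix $x_0\in H$. A map $x\colon[0,T]\to H$ is an admissible trajectory if it is right-continuous and of bounded variation, $x(0)=x_0\in C(0)$, and $x(t)\in C(t)$ for all $t\in[0,T]$. Its differential measure $dx$ is the $H$-valued Borel measure on $[0,T]$ with $dx(]s,t])=x(t)-x(s)$ for $0\le s\le t\le T$ and $dx(\{0\})=0$. A complete positive Radon measure on $[0,T]$ is the completion of a Borel measure that is finite on compact sets and inner regular with respect to compact sets. The map $x$ is a *solution in the sense of differential measures* of the sweeping process if it is an admissible trajectory and there is a complete positive Radon measure $\nu$ on $[0,T]$ such that $dx$ is absolutely continuous with respect to $\nu$ with density $\frac{dx}{d\nu}\in L^1_\nu([0,T];H)$ and $$\frac{dx}{d\nu}(t)\in -N^P(C(t);x(t))\quad\text{for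 }\nu\text{-a.e. }t\in[0,T].$$ The map $x$ is an *integral solution* of the sweeping process if it is an admissible trajectory and there is a complete positive Radon measure $\nu$ on $[0,T]$ such that $dx$ is absolutely continuous with respect to $\nu$ with density $v=\frac{dx}{d\nu}\in L^1_\nu([0,T];H)$ and, for every continuous $y\colon[0,T]\to H$ with $y(t)\in C(t)$ for $\nu$-a.e. $t$, $$\int_{[0,T]}\Bigl(\langle v(t),y(t)-x(t)\rangle+\frac{\|v(t)\|}{2\rho}\|y(t)-x(t)\|^2\Bigr)\,d\nu(t)\ge 0.$$ **Theorem 4.1.** Assume (H1), (H2) and (H3), and let $x\colon[0,T]\to H$ be a map. Then $x$ is an integral solution of the sweeping process if and only if it is a solution in the sense of differential measures of the sweeping process. -/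

import Mathlib

open MeasureTheory Set
open scoped ENNReal InnerProductSpace

noncomputable section

namespace SweepingProcess

section Geometry

variable {H : Type*} [NormedAddCommGroup H] [InnerProductSpace ℝ H]

/-- The proximal subdifferential of `f : H → ℝ ∪ {+∞}` at a point `x` of its effective domain:
the vectors `ζ` such that `f y ≥ f x + ⟪ζ, y - x⟫ - σ ‖y - x‖²` for all `y` in some open ball
around `x` (of positive radius) and some `σ ≥ 0`. It is empty off the effective domain. -/
def proximalSubdifferential (f : H → EReal) (x : H) : Set H :=
  {ζ | f x ≠ ⊤ ∧ ∃ σ : ℝ, 0 ≤ σ ∧ ∃ η : ℝ, 0 < η ∧ ∀ y ∈ Metric.ball x η,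
    f x + ((⟪ζ, y - x⟫_ℝ - σ * ‖y - x‖ ^ 2 : ℝ) : EReal) ≤ f y}

open scoped Classical in
/-- The indicator function of convex analysis: `0` on `S` and `+∞` off `S`. -/
def convexIndicator (S : Set H) (y : H) : EReal := if y ∈ S then 0 else ⊤

/-- The proximal normal cone `N^P(S; x)` of `S` at `x` (empty if `x ∉ S`). -/
def proximalNormalCone (S : Set H) (x : H) : Set H :=
  proximalSubdifferential (convexIndicator S) x

/-- The number `1 / (2ρ)` for `ρ ∈ (0, +∞]`, equal to `0` when `ρ = +∞`. -/
def halfInv (ρ : ℝ≥0∞) : ℝ := ((2 * ρ)⁻¹).toReal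

/-- `S` is nonempty, closed and `ρ`-uniformly prox-regular. -/
structure IsUniformlyProxRegular (ρ : ℝ≥0∞) (S : Set H) : Prop where
  nonempty : S.Nonempty
  isClosed : IsClosed S
  inner_le : ∀ x ∈ S, ∀ ζ ∈ proximalNormalCone S x, ∀ x' ∈ S,
    ⟪ζ, x' - x⟫_ℝ ≤ ‖ζ‖ * halfInv ρ * ‖x' - x‖ ^ 2

end Geometry

section Trajectories

variable {T : ℝ} {H : Type*} [NormedAddCommGroup H] [InnerProductSpace ℝ H] [CompleteSpace H]

instance instCompactIccSpace : CompactIccSpace (Icc (0 : ℝ) T) :=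
  ⟨fun {_ _} => isClosed_Icc.isCompact⟩

/-- The moving set has nonempty, closed, connected, `ρ`-uniformly prox-regular values. -/
def HasProxRegularValues (ρ : ℝ≥0∞) (C : Icc (0 : ℝ) T → Set H) : Prop :=
  ∀ t, (C t).Nonempty ∧ IsClosed (C t) ∧ IsConnected (C t) ∧ IsUniformlyProxRegular ρ (C t)

/-- The bounded selection-extension property along trajectories. A continuous
selection `y : K → H` is given as a function on `[0,T]` that is continuous on `K`; its values
off `K` play no role. -/
def HasBoundedSelectionExtension (C : Icc (0 : ℝ) T → Set H) : Prop :=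
  ∀ x : Icc (0 : ℝ) T → H, Bornology.IsBounded (range x) → (∀ t, x t ∈ C t) →
    ∀ η : ℝ, 0 < η → ∃ R : ℝ, 0 < R ∧
      ∀ K : Set (Icc (0 : ℝ) T), IsCompact K →
        ∀ y : Icc (0 : ℝ) T → H, ContinuousOn y K → (∀ t ∈ K, y t ∈ C t) →
          (∀ t ∈ K, ‖y t - x t‖ ≤ η) →
            ∃ ybar : Icc (0 : ℝ) T → H, Continuous ybar ∧ (∀ t, ybar t ∈ C t) ∧
              (∀ t ∈ K, ybar t = y t) ∧ ∀ t, ‖ybar t‖ ≤ R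

/-- Admissible trajectories for `C` with initial datum `x₀ ∈ C(0)`: right-continuous, of bounded
variation, starting at `x₀` and satisfying `x(t) ∈ C(t)` for all `t`. -/
structure IsAdmissible (C : Icc (0 : ℝ) T → Set H) (x₀ : H) (x : Icc (0 : ℝ) T → H) : Prop where
  rightContinuous : ∀ t, ContinuousWithinAt x (Ici t) t
  boundedVariation : BoundedVariationOn x univ
  initial : ∀ t : Icc (0 : ℝ) T, (t : ℝ) = 0 → x t = x₀ ∧ x₀ ∈ C t
  mem : ∀ t, x t ∈ C t

/-- Positive Radon measures on `[0,T]`: Borel measures that are finite on compact sets and inner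
regular with respect to compact sets on Borel sets. The corresponding complete Radon measure is
the completion; almost-everywhere statements, `Integrable` (which asks for a.e. strong
measurability) and Bochner integrals are by definition those of the completion. -/
def IsRadon (ν : Measure (Icc (0 : ℝ) T)) : Prop :=
  IsFiniteMeasureOnCompacts ν ∧ ν.InnerRegular

/-- The differential measure `dx` of the function `x` of bounded variation, i.e. the `H`-valued
measure with `dx(]s,t]) = x(t) - x(s)` (for right-continuous `x`) and no mass at `0`, is
absolutely continuous with respect to `ν`, with density `v ∈ L¹_ν([0,T]; H)`: `dx = v dν`. -/
def HasDensity (x : Icc (0 : ℝ) T → H) (ν : Measure (Icc (0 : ℝ) T))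
    (v : Icc (0 : ℝ) T → H) : Prop :=
  Integrable v ν ∧ ∃ hx : BoundedVariationOn x univ, hx.vectorMeasure = ν.withDensityᵥ v

/-- Solutions of the sweeping process in the sense of differential measures:
`dx/dν(t) ∈ -N^P(C(t); x(t))` for `ν`-a.e. `t`, for some Radon measure `ν`. -/
def IsDifferentialMeasureSolution (C : Icc (0 : ℝ) T → Set H) (x₀ : H)
    (x : Icc (0 : ℝ) T → H) : Prop :=
  IsAdmissible C x₀ x ∧
    ∃ ν : Measure (Icc (0 : ℝ) T), IsRadon ν ∧ ∃ v : Icc (0 : ℝ) T → H, HasDensity x ν v ∧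
      ∀ᵐ t ∂ν, -v t ∈ proximalNormalCone (C t) (x t)

/-- Integral solutions of the sweeping process. The integrand below is `ν`-integrable, since `v`
is and since `x` and `y` are bounded and strongly measurable. -/
def IsIntegralSolution (ρ : ℝ≥0∞) (C : Icc (0 : ℝ) T → Set H) (x₀ : H)
    (x : Icc (0 : ℝ) T → H) : Prop :=
  IsAdmissible C x₀ x ∧
    ∃ ν : Measure (Icc (0 : ℝ) T), IsRadon ν ∧ ∃ v : Icc (0 : ℝ) T → H, HasDensity x ν v ∧
      ∀ y : Icc (0 : ℝ) T → H, Continuous y → (∀ᵐ t ∂ν, y t ∈ C t) →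
        0 ≤ ∫ t, (⟪v t, y t - x t⟫_ℝ + ‖v t‖ * halfInv ρ * ‖y t - x t‖ ^ 2) ∂ν

end Trajectories

end SweepingProcess

end

open Filter Topology TopologicalSpace

namespace SweepingProcess

/-! If `-v t` is a proximal normal, uniform prox-regularity makes the integrand nonnegative at `t`;
integrate. For the converse, Lusin's theorem and bounded extension carry the integral inequality to
bounded measurable selections (`integral_proxIntegrand_nonneg_of_stronglyMeasurable`). Testing it on
selections equal to `y` on a Borel set and to `x` off it localises the inequality to almost every
`t`, for each continuous `y`. A separability argument makes the null set independent of `y`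
(`ae_forall_proxIntegrand_nonneg`). Every point of `C t` is the value at `t` of some continuous
selection, so at such `t` the inequality holds against all of `C t`: this is proximal normality of
`-v t`. -/

/-- **Lusin's theorem** for bounded vector-valued functions on a compact metric space. -/
theorem exists_isCompact_measure_compl_lt_continuousOn {X E : Type*} [MetricSpace X]
    [CompactSpace X] [MeasurableSpace X] [BorelSpace X] [NormedAddCommGroup E] [NormedSpace ℝ E]
    (μ : Measure X) [IsFiniteMeasure μ] {f : X → E} (hf : StronglyMeasurable f) {B : ℝ}
    (hB : ∀ t, ‖f t‖ ≤ B) {ε : ℝ≥0∞} (hε : 0 < ε) :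
    ∃ K : Set X, IsCompact K ∧ μ Kᶜ < ε ∧ ContinuousOn f K := by
  have hmem : MemLp f 1 μ :=
    MemLp.of_bound hf.aestronglyMeasurable B (Eventually.of_forall hB)
  have happrox (n : ℕ) : ∃ g : BoundedContinuousFunction X E,
      eLpNorm (f - (g : X → E)) 1 μ ≤ ((n : ℝ≥0∞) + 1)⁻¹ ∧ MemLp g 1 μ :=
    hmem.exists_boundedContinuous_eLpNorm_sub_le ENNReal.one_ne_top
      (ENNReal.inv_ne_zero.2 (by finiteness))
  choose g hg hgmem using happrox
  have hlim : Tendsto (fun n => eLpNorm ((g n : X → E) - f) 1 μ) atTop (𝓝 0) := by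
    have h0 : Tendsto (fun n : ℕ => ((n : ℝ≥0∞) + 1)⁻¹) atTop (𝓝 0) := by
      have := (tendsto_add_atTop_iff_nat 1).2 ENNReal.tendsto_inv_nat_nhds_zero
      simpa using this
    refine tendsto_of_tendsto_of_tendsto_of_le_of_le tendsto_const_nhds h0
      (fun _ => zero_le) fun n => ?_
    rw [eLpNorm_sub_comm]
    exact hg n
  obtain ⟨ns, -, hns⟩ := (tendstoInMeasure_of_tendsto_eLpNorm one_ne_zero
    (fun n => (hgmem n).1) hmem.1 hlim).exists_seq_tendsto_ae
  -- Egorov's theorem takes a real parameter and bounds the exceptional set non-strictly, hence `δ`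
  -- strictly below `ε / 2`.
  obtain ⟨δ, hδ, hδε⟩ := ENNReal.lt_iff_exists_nnreal_btwn.1 (ENNReal.half_pos hε.ne')
  have hδ0 : (0 : ℝ) < δ := by exact_mod_cast hδ
  obtain ⟨A, hA, hAδ, hunif⟩ := tendstoUniformlyOn_of_ae_tendsto' (μ := μ)
    (f := fun n => (g (ns n) : X → E)) (fun n =>
      (g (ns n)).continuous.stronglyMeasurable_of_hasCompactSupport (.of_compactSpace _)) hf hns hδ0
  obtain ⟨K, hKA, hK, hKε⟩ := hA.compl.exists_isClosed_sdiff_lt (measure_ne_top μ _)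
    (ENNReal.half_pos hε.ne').ne'
  refine ⟨K, hK.isCompact, ?_, (hunif.mono hKA).continuousOn
    (Frequently.of_forall fun n => (g (ns n)).continuous.continuousOn)⟩
  calc μ Kᶜ ≤ μ (A ∪ (Aᶜ \ K)) := measure_mono fun t ht => by
        by_cases h : t ∈ A
        · exact Or.inl h
        · exact Or.inr ⟨h, ht⟩
    _ ≤ μ A + μ (Aᶜ \ K) := measure_union_le _ _
    _ < ε / 2 + ε / 2 := by
        refine ENNReal.add_lt_add (hAδ.trans_lt ?_) hKε
        simpa using hδε
    _ = ε := ENNReal.add_halves ε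

/-- A right-continuous function on a compact interval is strongly measurable. -/
theorem stronglyMeasurable_of_rightContinuous {T : ℝ} (hT : 0 ≤ T) {E : Type*}
    [TopologicalSpace E] [PseudoMetrizableSpace E] {x : Icc (0 : ℝ) T → E}
    (hx : ∀ t, ContinuousWithinAt x (Ici t) t) : StronglyMeasurable x := by
  -- `ψ n (φ n t)` is the right endpoint, clipped at `T`, of the grid cell of mesh `1 / (n + 1)`
  -- containing `t`. It tends to `t` from the right and takes countably many values.
  let φ (n : ℕ) (t : Icc (0 : ℝ) T) : ℤ := ⌊((n : ℝ) + 1) * t⌋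
  let ψ (n : ℕ) (k : ℤ) : Icc (0 : ℝ) T := projIcc 0 T hT ((k + 1) / ((n : ℝ) + 1))
  have hφ (n : ℕ) : Measurable (φ n) :=
    Int.measurable_floor.comp (measurable_subtype_coe.const_mul _)
  have hψ (t : Icc (0 : ℝ) T) : Tendsto (fun n => ψ n (φ n t)) atTop (𝓝[≥] t) := by
    have hlow (n : ℕ) : (t : ℝ) ≤ ((φ n t : ℝ) + 1) / ((n : ℝ) + 1) := by
      rw [le_div_iff₀ (by positivity), mul_comm]
      exact (Int.lt_floor_add_one _).le
    have hup (n : ℕ) : ((φ n t : ℝ) + 1) / ((n : ℝ) + 1) ≤ t + 1 / ((n : ℝ) + 1) := by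
      rw [add_div]
      gcongr
      rw [div_le_iff₀ (by positivity), mul_comm]
      exact Int.floor_le _
    have hlim : Tendsto (fun n : ℕ => ((φ n t : ℝ) + 1) / ((n : ℝ) + 1)) atTop (𝓝 (t : ℝ)) :=
      tendsto_of_tendsto_of_tendsto_of_le_of_le tendsto_const_nhds
        (by simpa using tendsto_const_nhds.add (tendsto_one_div_add_atTop_nhds_zero_nat (𝕜 := ℝ)))
        hlow hup
    refine tendsto_nhdsWithin_iff.2 ⟨?_, Eventually.of_forall fun n => ?_⟩
    · have := (continuous_projIcc (h := hT)).continuousAt.tendsto.comp hlim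
      rwa [projIcc_val] at this
    · have := monotone_projIcc hT (hlow n)
      rwa [projIcc_val] at this
  refine stronglyMeasurable_of_tendsto atTop
    (f := fun n t => x (ψ n (φ n t))) (fun n => ?_)
    (tendsto_pi_nhds.2 fun t => (hx t).tendsto.comp (hψ t))
  exact (StronglyMeasurable.of_discrete (f := fun k => x (ψ n k))).comp_measurable (hφ n)

/-- Through each point of the graph of `C` there is a continuous selection. -/
theorem HasBoundedSelectionExtension.exists_continuous_selection {T : ℝ}
    {H : Type*} [NormedAddCommGroup H] {C : Icc (0 : ℝ) T → Set H} {x : Icc (0 : ℝ) T → H}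
    (h3 : HasBoundedSelectionExtension C) (hxb : Bornology.IsBounded (range x))
    (hxC : ∀ t, x t ∈ C t) {t : Icc (0 : ℝ) T} {z : H} (hz : z ∈ C t) :
    ∃ y : C(Icc (0 : ℝ) T, H), (∀ s, y s ∈ C s) ∧ y t = z := by
  obtain ⟨R, -, hR⟩ := h3 x hxb hxC (‖z - x t‖ + 1) (by positivity)
  obtain ⟨y, hy, hyC, hyt, -⟩ := hR {t} isCompact_singleton (fun _ => z) continuousOn_const
    (by simpa using hz) (by simp)
  exact ⟨⟨y, hy⟩, hyC, hyt t rfl⟩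

theorem IsAdmissible.isBounded_range {T : ℝ} {H : Type*} [NormedAddCommGroup H]
    {C : Icc (0 : ℝ) T → Set H} {x₀ : H} {x : Icc (0 : ℝ) T → H} (hx : IsAdmissible C x₀ x) :
    Bornology.IsBounded (range x) := by
  refine Metric.isBounded_range_iff.2 ⟨(eVariationOn x univ).toReal, fun s t => ?_⟩
  exact hx.boundedVariation.dist_le (mem_univ s) (mem_univ t)

/-! ### Bounds and integrability of the integrand -/

section Integrand

variable {H : Type*} [NormedAddCommGroup H] [InnerProductSpace ℝ H]

theorem halfInv_nonneg (ρ : ℝ≥0∞) : 0 ≤ halfInv ρ := ENNReal.toReal_nonneg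

theorem mem_proximalNormalCone_of_inner_le {S : Set H} {x ζ : H} (hx : x ∈ S) {σ : ℝ}
    (hσ : 0 ≤ σ) (h : ∀ y ∈ S, ⟪ζ, y - x⟫_ℝ ≤ σ * ‖y - x‖ ^ 2) :
    ζ ∈ proximalNormalCone S x := by
  refine ⟨by simp [convexIndicator, hx], σ, hσ, 1, one_pos, fun y _ => ?_⟩
  by_cases hy : y ∈ S
  · simp only [convexIndicator, hx, hy, if_true, zero_add]
    exact_mod_cast sub_nonpos.2 (h y hy)
  · simp [convexIndicator, hy]

/-- The integrand `⟪v, z⟫ + ‖v‖ / (2ρ) ‖z‖²` of the integral inequality. -/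
noncomputable def proxIntegrand (ρ : ℝ≥0∞) (v z : H) : ℝ := ⟪v, z⟫_ℝ + ‖v‖ * halfInv ρ * ‖z‖ ^ 2

theorem abs_proxIntegrand_le (ρ : ℝ≥0∞) (v : H) {z : H} {B : ℝ} (hz : ‖z‖ ≤ B) :
    |proxIntegrand ρ v z| ≤ ‖v‖ * (B + halfInv ρ * B ^ 2) := by
  have h := halfInv_nonneg ρ
  calc |proxIntegrand ρ v z| ≤ |⟪v, z⟫_ℝ| + |‖v‖ * halfInv ρ * ‖z‖ ^ 2| := abs_add_le _ _
    _ ≤ ‖v‖ * ‖z‖ + ‖v‖ * halfInv ρ * ‖z‖ ^ 2 := by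
        rw [abs_of_nonneg (by positivity : 0 ≤ ‖v‖ * halfInv ρ * ‖z‖ ^ 2)]
        gcongr
        exact abs_real_inner_le_norm v z
    _ ≤ ‖v‖ * B + ‖v‖ * halfInv ρ * B ^ 2 := by gcongr
    _ = ‖v‖ * (B + halfInv ρ * B ^ 2) := by ring

theorem integrable_proxIntegrand {X : Type*} [MeasurableSpace X] {μ : Measure X} (ρ : ℝ≥0∞)
    {v z : X → H} (hv : Integrable v μ) (hz : AEStronglyMeasurable z μ) {B : ℝ}
    (hB : ∀ t, ‖z t‖ ≤ B) : Integrable (fun t => proxIntegrand ρ (v t) (z t)) μ := by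
  refine (hv.norm.mul_const (B + halfInv ρ * B ^ 2)).mono' ?_
    (Eventually.of_forall fun t => abs_proxIntegrand_le ρ (v t) (hB t))
  exact (hv.1.inner hz).add ((hv.1.norm.mul_const _).mul (hz.norm.pow 2))

end Integrand

/-! ### From the integral inequality to a pointwise one -/

section Selections

variable {T : ℝ} {H : Type*} [NormedAddCommGroup H] [InnerProductSpace ℝ H]
  {C : Icc (0 : ℝ) T → Set H} {x v : Icc (0 : ℝ) T → H} {ν : Measure (Icc (0 : ℝ) T)} {ρ : ℝ≥0∞}

/-- The integral inequality extends from continuous selections to bounded strongly measurable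
selections: by Lusin's theorem such a selection is continuous on large compact sets, and the
extensions of its restrictions are uniformly bounded. -/
theorem integral_proxIntegrand_nonneg_of_stronglyMeasurable [IsFiniteMeasure ν]
    (h3 : HasBoundedSelectionExtension C) (hx : StronglyMeasurable x)
    (hxb : Bornology.IsBounded (range x)) (hxC : ∀ t, x t ∈ C t) (hv : Integrable v ν)
    (hint : ∀ y : Icc (0 : ℝ) T → H, Continuous y → (∀ t, y t ∈ C t) →
      0 ≤ ∫ t, proxIntegrand ρ (v t) (y t - x t) ∂ν)
    {w : Icc (0 : ℝ) T → H} (hw : StronglyMeasurable w) (hwb : Bornology.IsBounded (range w))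
    (hwC : ∀ t, w t ∈ C t) : 0 ≤ ∫ t, proxIntegrand ρ (v t) (w t - x t) ∂ν := by
  obtain ⟨Bx, hBx0, hBx⟩ := hxb.exists_pos_norm_le
  obtain ⟨Bw, hBw0, hBw⟩ := hwb.exists_pos_norm_le
  simp only [forall_mem_range] at hBx hBw
  have hwx (t) : ‖w t - x t‖ ≤ Bw + Bx := (norm_sub_le _ _).trans (add_le_add (hBw t) (hBx t))
  -- `R` is fixed before the compact sets, so one bound serves all the extensions.
  obtain ⟨R, hR0, hR⟩ := h3 x hxb hxC (Bw + Bx) (add_pos hBw0 hBx0)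
  have hK (n : ℕ) : ∃ K : Set (Icc (0 : ℝ) T),
      IsCompact K ∧ ν Kᶜ < ((n : ℝ≥0∞) + 1)⁻¹ ∧ ContinuousOn w K :=
    exists_isCompact_measure_compl_lt_continuousOn ν hw hBw
      (ENNReal.inv_pos.2 (by finiteness))
  choose K hKc hKν hKw using hK
  choose y hy hyC hyK hyR using fun n =>
    hR (K n) (hKc n) w (hKw n) (fun t _ => hwC t) fun t _ => hwx t
  have hyx (n t) : ‖y n t - x t‖ ≤ R + Bx :=
    (norm_sub_le _ _).trans (add_le_add (hyR n t) (hBx t))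
  have hgw : Integrable (fun t => proxIntegrand ρ (v t) (w t - x t)) ν :=
    integrable_proxIntegrand ρ hv (hw.sub hx).aestronglyMeasurable hwx
  have hgy (n) : Integrable (fun t => proxIntegrand ρ (v t) (y n t - x t)) ν :=
    integrable_proxIntegrand ρ hv
      (((hy n).aestronglyMeasurable).sub hx.aestronglyMeasurable) (hyx n)
  -- `‖v t‖ * M` dominates the difference of the integrands along `y n` and `w`, which agree on `K
  -- n`.
  set M : ℝ := (R + Bx + halfInv ρ * (R + Bx) ^ 2) + (Bw + Bx + halfInv ρ * (Bw + Bx) ^ 2)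
  have hbound (n : ℕ) : -(∫ t in (K n)ᶜ, ‖v t‖ * M ∂ν) ≤
      ∫ t, proxIntegrand ρ (v t) (w t - x t) ∂ν := by
    have hle : ∫ t, proxIntegrand ρ (v t) (y n t - x t) ∂ν ≤
        ∫ t, (proxIntegrand ρ (v t) (w t - x t) + (K n)ᶜ.indicator (fun t => ‖v t‖ * M) t) ∂ν := by
      refine integral_mono (hgy n) (hgw.add ((hv.norm.mul_const M).indicator
        (hKc n).measurableSet.compl)) fun t => ?_
      by_cases ht : t ∈ K n
      · simp [ht, hyK n t ht]
      · have h1 := abs_le.1 (abs_proxIntegrand_le ρ (v t) (hyx n t))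
        have h2 := abs_le.1 (abs_proxIntegrand_le ρ (v t) (hwx t))
        simp only [indicator_of_mem (mem_compl ht), M, mul_add] at h1 h2 ⊢
        linarith
    rw [integral_add hgw ((hv.norm.mul_const M).indicator (hKc n).measurableSet.compl),
      integral_indicator (hKc n).measurableSet.compl] at hle
    linarith [hint (y n) (hy n) (hyC n)]
  have hKlim : Tendsto (ν ∘ fun n => (K n)ᶜ) atTop (𝓝 0) := by
    have h0 : Tendsto (fun n : ℕ => ((n : ℝ≥0∞) + 1)⁻¹) atTop (𝓝 0) := by
      simpa using (tendsto_add_atTop_iff_nat 1).2 ENNReal.tendsto_inv_nat_nhds_zero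
    exact tendsto_of_tendsto_of_tendsto_of_le_of_le tendsto_const_nhds h0
      (fun _ => zero_le) fun n => (hKν n).le
  have hlim := ((hv.norm.mul_const M).tendsto_setIntegral_nhds_zero hKlim).neg
  rw [neg_zero] at hlim
  exact le_of_tendsto' hlim hbound

/-- The integral inequality holds pointwise almost everywhere along each continuous selection. -/
theorem ae_proxIntegrand_nonneg [IsFiniteMeasure ν]
    (h3 : HasBoundedSelectionExtension C) (hx : StronglyMeasurable x)
    (hxb : Bornology.IsBounded (range x)) (hxC : ∀ t, x t ∈ C t) (hv : Integrable v ν)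
    (hint : ∀ y : Icc (0 : ℝ) T → H, Continuous y → (∀ t, y t ∈ C t) →
      0 ≤ ∫ t, proxIntegrand ρ (v t) (y t - x t) ∂ν)
    {y : Icc (0 : ℝ) T → H} (hy : Continuous y) (hyC : ∀ t, y t ∈ C t) :
    ∀ᵐ t ∂ν, 0 ≤ proxIntegrand ρ (v t) (y t - x t) := by
  classical
  have hyb : Bornology.IsBounded (range y) := (isCompact_range hy).isBounded
  have hym : StronglyMeasurable y :=
    hy.stronglyMeasurable_of_hasCompactSupport (HasCompactSupport.of_compactSpace _)
  obtain ⟨B, hB⟩ := (hyb.sub hxb).exists_norm_le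
  refine ae_nonneg_of_forall_setIntegral_nonneg (integrable_proxIntegrand ρ hv
    (hym.sub hx).aestronglyMeasurable fun t =>
      hB _ (Set.sub_mem_sub (mem_range_self t) (mem_range_self t))) fun A hA _ => ?_
  have hnonneg := integral_proxIntegrand_nonneg_of_stronglyMeasurable h3 hx hxb hxC hv hint
    (w := A.piecewise y x) (hym.piecewise hA hx)
    ((hyb.union hxb).subset (by
      rintro _ ⟨t, rfl⟩
      by_cases ht : t ∈ A <;> simp [ht]))
    (fun t => by by_cases ht : t ∈ A <;> simp [ht, hyC, hxC])
  rw [← integral_indicator hA]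
  refine hnonneg.trans_eq (integral_congr_ae (Eventually.of_forall fun t => ?_))
  by_cases ht : t ∈ A <;> simp [ht, proxIntegrand]

/-- If the integrand is a.e. nonnegative along each continuous selection, then almost everywhere it
is nonnegative along all of them. The integrand at `t` depends on `y t` only through its projection
to a separable subspace containing `x` and `v`, and through its norm, so that countably many
selections suffice. -/
theorem ae_forall_proxIntegrand_nonneg [CompleteSpace H] {Y : Set C(Icc (0 : ℝ) T, H)}
    (hx : StronglyMeasurable x) (hv : StronglyMeasurable v)
    (hY : ∀ y ∈ Y, ∀ᵐ t ∂ν, 0 ≤ proxIntegrand ρ (v t) (y t - x t)) :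
    ∀ᵐ t ∂ν, ∀ y ∈ Y, 0 ≤ proxIntegrand ρ (v t) (y t - x t) := by
  -- `H` may be nonseparable, but strongly measurable functions have separable range.
  let F : Submodule ℝ H := (Submodule.span ℝ (range x ∪ range v)).topologicalClosure
  have hxF (t) : x t ∈ F :=
    Submodule.le_topologicalClosure _ (Submodule.subset_span (Or.inl (mem_range_self t)))
  have hvF (t) : v t ∈ F :=
    Submodule.le_topologicalClosure _ (Submodule.subset_span (Or.inr (mem_range_self t)))
  have hFsep : IsSeparable (F : Set H) := by
    rw [Submodule.topologicalClosure_coe]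
    exact (hx.isSeparable_range.union hv.isSeparable_range).span.closure
  have : SeparableSpace F := hFsep.separableSpace
  have : SecondCountableTopology F := UniformSpace.secondCountable_of_separable F
  have : CompleteSpace F := (Submodule.isClosed_topologicalClosure _).completeSpace_coe
  let Φ (y : C(Icc (0 : ℝ) T, H)) : C(Icc (0 : ℝ) T, F × ℝ) :=
    ⟨fun t => (F.orthogonalProjectionOnto (y t), ‖y t‖ ^ 2), by fun_prop⟩
  -- Here `p.2` stands for `‖y t‖ ^ 2`, from expanding `‖y t - x t‖ ^ 2`; the inner products see
  -- only the projection.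
  let G (t : Icc (0 : ℝ) T) (p : F × ℝ) : ℝ :=
    ⟪v t, p.1⟫_ℝ - ⟪v t, x t⟫_ℝ +
      ‖v t‖ * halfInv ρ * (p.2 - 2 * ⟪x t, p.1⟫_ℝ + ‖x t‖ ^ 2)
  have hG (y : C(Icc (0 : ℝ) T, H)) (t : Icc (0 : ℝ) T) :
      G t (Φ y t) = proxIntegrand ρ (v t) (y t - x t) := by
    have hproj {u : H} (hu : u ∈ F) :
        ⟪u, (F.orthogonalProjectionOnto (y t) : H)⟫_ℝ = ⟪u, y t⟫_ℝ := by
      rw [← F.inner_orthogonalProjectionOnto_eq_of_mem_left ⟨u, hu⟩ (y t)]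
      rfl
    simp only [G, Φ, ContinuousMap.coe_mk, proxIntegrand, hproj (hvF t), hproj (hxF t),
      inner_sub_right, norm_sub_sq_real, real_inner_comm]
  have hGc (t) : Continuous fun φ : C(Icc (0 : ℝ) T, F × ℝ) => G t (φ t) := by
    have h1 : Continuous fun φ : C(Icc (0 : ℝ) T, F × ℝ) => φ t :=
      ContinuousEvalConst.continuous_eval_const t
    have h2 : Continuous (G t) := by fun_prop
    exact h2.comp h1
  -- `D` is taken inside `Φ '' Y`, so each of its elements comes from a selection.
  obtain ⟨D, hDY, hDc, hD⟩ := (IsSeparable.of_separableSpace (Φ '' Y)).exists_countable_dense_subset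
  have hae : ∀ᵐ t ∂ν, ∀ φ ∈ D, 0 ≤ G t (φ t) := by
    refine (ae_ball_iff hDc).2 fun φ hφ => ?_
    obtain ⟨y, hy, rfl⟩ := hDY hφ
    simpa only [hG] using hY y hy
  filter_upwards [hae] with t ht y hy
  rw [← hG]
  exact closure_minimal ht (isClosed_Ici.preimage (hGc t)) (hD (mem_image_of_mem Φ hy))

end Selections

/-! ### The two implications -/

section Trajectories

variable {T : ℝ} {H : Type*} [NormedAddCommGroup H] [InnerProductSpace ℝ H] [CompleteSpace H]
  {C : Icc (0 : ℝ) T → Set H} {x₀ : H} {x : Icc (0 : ℝ) T → H} {ρ : ℝ≥0∞}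

theorem IsDifferentialMeasureSolution.isIntegralSolution (h1 : HasProxRegularValues ρ C)
    (h : IsDifferentialMeasureSolution C x₀ x) : IsIntegralSolution ρ C x₀ x := by
  obtain ⟨hx, ν, hν, v, hv, hae⟩ := h
  refine ⟨hx, ν, hν, v, hv, fun y _ hyC => integral_nonneg_of_ae ?_⟩
  filter_upwards [hae, hyC] with t ht hyt
  have := (h1 t).2.2.2.inner_le (x t) (hx.mem t) (-v t) ht (y t) hyt
  rw [inner_neg_left, norm_neg] at this
  simp only [Pi.zero_apply]
  linarith

/-- The selection through a point `z` of `C t` varies with `t` and `z`, which is why a null set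
common to all selections is needed. -/
theorem IsIntegralSolution.isDifferentialMeasureSolution (hT : 0 ≤ T)
    (h3 : HasBoundedSelectionExtension C) (h : IsIntegralSolution ρ C x₀ x) :
    IsDifferentialMeasureSolution C x₀ x := by
  obtain ⟨hx, ν, hν, v, hv, hint⟩ := h
  refine ⟨hx, ν, hν, v, hv, ?_⟩
  have := hν.1
  have hxm := stronglyMeasurable_of_rightContinuous hT hx.rightContinuous
  have hxb := hx.isBounded_range
  have hvm := hv.1.1
  let Y : Set C(Icc (0 : ℝ) T, H) := {y | ∀ t, y t ∈ C t}
  -- The representative `hvm.mk v` is strongly measurable everywhere, as the separability of its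
  -- range requires.
  have hY : ∀ᵐ t ∂ν, ∀ y ∈ Y, 0 ≤ proxIntegrand ρ (hvm.mk v t) (y t - x t) := by
    refine ae_forall_proxIntegrand_nonneg hxm hvm.stronglyMeasurable_mk fun y hy => ?_
    filter_upwards [ae_proxIntegrand_nonneg h3 hxm hxb hx.mem hv.1
      (fun z hz hzC => hint z hz (Eventually.of_forall hzC)) y.continuous hy, hvm.ae_eq_mk]
      with t ht hvt
    rwa [← hvt]
  filter_upwards [hY, hvm.ae_eq_mk] with t ht hvt
  refine mem_proximalNormalCone_of_inner_le (hx.mem t)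
    (mul_nonneg (norm_nonneg (v t)) (halfInv_nonneg ρ)) fun z hz => ?_
  obtain ⟨y, hyC, rfl⟩ := h3.exists_continuous_selection hxb hx.mem hz
  have := ht y hyC
  rw [← hvt, proxIntegrand] at this
  rw [inner_neg_left]
  linarith

end Trajectories

end SweepingProcess

theorem theorem4p1 {T : ℝ} (hT : 0 < T) {H : Type*} [NormedAddCommGroup H]
    [InnerProductSpace ℝ H] [CompleteSpace H] {ρ : ℝ≥0∞} (hρ : 0 < ρ)
    (C : Icc (0 : ℝ) T → Set H)
    (h1 : SweepingProcess.HasProxRegularValues ρ C)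
    (h2 : LowerHemicontinuous C)
    (h3 : SweepingProcess.HasBoundedSelectionExtension C)
    (x₀ : H) (x : Icc (0 : ℝ) T → H) :
    SweepingProcess.IsIntegralSolution ρ C x₀ x ↔
      SweepingProcess.IsDifferentialMeasureSolution C x₀ x :=
  ⟨fun h => h.isDifferentialMeasureSolution hT.le h3, fun h => h.isIntegralSolution h1⟩
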